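/- Let $a\ge 2$ be an integer and let $q\in\mathbb C$ with $|q|<1$. Put $E(q)=\prod_{n\ge1}(1-q^n)$, $\vec 1_a=(1,\dots,1)\in\mathbb Z^a$ and $\vec b_a=(0,1,\dots,a-1)$. For every complex $z\neq 0$ the series $$C_a(z;q):=\sum_{\substack{\vec n=(n_0,\dots,n_{a-1})\in\mathbb Z^a\\ \vec n\cdot\vec 1_a=0}} q^{\frac a2\,\vec n\cdot\vec n+\vec b_a\cdot\vec n}\sum_{j=0}^{a-1}z^{an_j+j}$$ converges absolutely, and $$C_a(z;q)=E(q)\,E(q^a)^{a-2}\prod_{n=1}^\infty\frac{(1-z^aq^{a(n-1)})(1-z^{-a}q^{an})}{(1-zq^{n-1})(1-z^{-1}q^n)}.$$ The infinite product on the right-hand side converges at every $z\ne0$ at which no denominator vanishes. At the remaining points $z\neq0$ the right-hand side is understood as its limit as $w\to z$, $w\ne z$; this limit exists and equals $C_a(z;q)$. -/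

import Mathlib

open Filter Topology

/-- The exponent `(a / 2) n · n + b_a · n` with `b_a = (0, 1, …, a - 1)`, as an integer. On the
vectors with `n · 1 = 0`, which are the only ones used, the division by two is exact
(`two_mul_coreExponent`). -/
def coreExponent (a : ℕ) (n : Fin a → ℤ) : ℤ :=
  (a : ℤ) * (∑ i, n i * n i) / 2 + ∑ i : Fin a, ((i : ℕ) : ℤ) * n i

theorem two_mul_coreExponent (a : ℕ) (n : Fin a → ℤ) (hn : ∑ i, n i = 0) :
    2 * coreExponent a n =
      (a : ℤ) * (∑ i, n i * n i) + 2 * ∑ i : Fin a, ((i : ℕ) : ℤ) * n i := by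
  have h : (2 : ℤ) ∣ ∑ i, n i * n i := by
    have h1 : (2 : ℤ) ∣ ∑ i, (n i * n i - n i) := by
      refine Finset.dvd_sum fun i _ => ?_
      have := Int.even_mul_pred_self (n i)
      rw [mul_sub, mul_one] at this
      exact this.two_dvd
    rwa [Finset.sum_sub_distrib, hn, sub_zero] at h1
  have h2 := Int.mul_ediv_cancel' (Dvd.dvd.mul_left h (a : ℤ))
  unfold coreExponent
  linarith

/-- The lattice of all `n ∈ ℤ^a` with `n · 1 = 0`. -/
abbrev ZeroSumLattice (a : ℕ) : Type := {n : Fin a → ℤ // ∑ i, n i = 0}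

/-- The summand `q ^ ((a / 2) n · n + b_a · n) * ∑_{j < a} z ^ (a n_j + j)`. -/
noncomputable def coreThetaTerm (a : ℕ) (z q : ℂ) (n : ZeroSumLattice a) : ℂ :=
  q ^ coreExponent a n.1 * ∑ j : Fin a, z ^ ((a : ℤ) * n.1 j + ((j : ℕ) : ℤ))

/-- The multidimensional theta function `C_a(z; q)`. -/
noncomputable def coreTheta (a : ℕ) (z q : ℂ) : ℂ :=
  ∑' n : ZeroSumLattice a, coreThetaTerm a z q n

/-- `E(q) = ∏_{n ≥ 1} (1 - q ^ n)`. -/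
noncomputable def eulerE (q : ℂ) : ℂ := ∏' n : ℕ, (1 - q ^ (n + 1))

/-- The factor `(1 - z q ^ (n - 1)) (1 - z⁻¹ q ^ n)` of `[z; q]_∞`, with `n` shifted so that it
starts from zero. -/
noncomputable def bracketFactor (z q : ℂ) (n : ℕ) : ℂ :=
  (1 - z * q ^ n) * (1 - z⁻¹ * q ^ (n + 1))

/-- The product side
`E(q) E(q ^ a) ^ (a - 2) ∏_{n ≥ 1} (1 - z ^ a q ^ (a (n - 1))) (1 - z ^ (-a) q ^ (a n)) /
((1 - z q ^ (n - 1)) (1 - z⁻¹ q ^ n))`. -/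
noncomputable def coreProduct (a : ℕ) (z q : ℂ) : ℂ :=
  eulerE q * eulerE (q ^ a) ^ (a - 2) *
    ∏' n : ℕ, bracketFactor (z ^ a) (q ^ a) n / bracketFactor z q n

/-! Write θ(z;q) = Σ (-1)^k q^(k(k-1)/2) z^k. Sending (j, n) to (j + 1, σ(n - e_j)), with σ the
cyclic shift, gives C_a(z) = z^(a-1) C_a(qz), while θ(z;q) = -z θ(qz;q). So the Laurent coefficients
of F(z) = C_a(z) θ(z;q) satisfy c(N + a) = -q^N c(N), and F is a combination of the a series z^j
θ(q^j z^a; q^a). Moreover F vanishes at all a-th roots of unity: a geometric sum kills C_a except at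
z = 1, where θ vanishes. By Vandermonde only j = 0 survives, and F(z) = c θ(z^a; q^a)
(`exists_coreTheta_mul_thetaSeries`).

Jacobi's triple product (`thetaSeries_eq`) turns both thetas into products. The constant c is found
by dividing by 1 - z and letting z tend to 1. This needs C_a(1), a multiple of the generating
function of a-cores, which `tsum_coreExponent` evaluates by the same recurrence principle with
period 1. The identity cleared of denominators holds at every z ≠ 0; continuity of C_a then gives
the limits. The case q = 0 is separate, because the recurrences divide by q. -/

/-! ### Infinite products -/

/-- The infinite `q`-Pochhammer symbol `(u; q)_∞ = ∏_{n ≥ 0} (1 - u q ^ n)`. -/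
noncomputable def qPoch (u q : ℂ) : ℂ := ∏' n : ℕ, (1 - u * q ^ n)

theorem summable_norm_mul_pow {q : ℂ} (hq : ‖q‖ < 1) (u : ℂ) :
    Summable fun n : ℕ => ‖-(u * q ^ n)‖ := by
  simpa [norm_mul, norm_pow] using
    (summable_geometric_of_lt_one (norm_nonneg q) hq).mul_left ‖u‖

theorem multipliable_qPoch {q : ℂ} (hq : ‖q‖ < 1) (u : ℂ) :
    Multipliable fun n : ℕ => 1 - u * q ^ n := by
  simpa [sub_eq_add_neg] using multipliable_one_add_of_summable (summable_norm_mul_pow hq u)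

theorem qPoch_ne_zero {q : ℂ} (hq : ‖q‖ < 1) {u : ℂ} (hu : ∀ n : ℕ, 1 - u * q ^ n ≠ 0) :
    qPoch u q ≠ 0 := by
  have := tprod_one_add_ne_zero_of_summable (f := fun n : ℕ => -(u * q ^ n))
    (fun n => by simpa [sub_eq_add_neg] using hu n) (summable_norm_mul_pow hq u)
  simpa [qPoch, sub_eq_add_neg] using this

/-- Isolates the zero at u = 1, which is divided out when the constant is computed. -/
theorem qPoch_eq_one_sub_mul {q : ℂ} (hq : ‖q‖ < 1) (u : ℂ) :
    qPoch u q = (1 - u) * qPoch (u * q) q := by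
  have h : Tendsto (fun n : ℕ => ∏ i ∈ Finset.range (n + 1), (1 - u * q ^ i)) atTop
      (𝓝 (qPoch u q)) :=
    (tendsto_add_atTop_iff_nat 1).2 (multipliable_qPoch hq u).hasProd.tendsto_prod_nat
  have h2 := ((multipliable_qPoch hq (u * q)).hasProd.tendsto_prod_nat).const_mul (1 - u)
  refine tendsto_nhds_unique h (h2.congr fun n => ?_)
  rw [Finset.prod_range_succ', mul_comm]
  simp [pow_succ', mul_assoc]

theorem one_sub_ne_zero_of_norm_lt_one {u : ℂ} (hu : ‖u‖ < 1) : 1 - u ≠ 0 := by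
  intro h
  rw [← sub_eq_zero.1 h] at hu
  simp at hu

theorem qPoch_ne_zero_of_norm_lt_one {q : ℂ} (hq : ‖q‖ < 1) {u : ℂ} (hu : ‖u‖ < 1) :
    qPoch u q ≠ 0 := by
  refine qPoch_ne_zero hq fun n => one_sub_ne_zero_of_norm_lt_one ?_
  rw [norm_mul, norm_pow]
  exact (mul_le_of_le_one_right (norm_nonneg u) (pow_le_one₀ (norm_nonneg q) hq.le)).trans_lt hu

theorem eulerE_eq_qPoch (q : ℂ) : eulerE q = qPoch q q := by
  simp [eulerE, qPoch, pow_succ']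

theorem eulerE_ne_zero {q : ℂ} (hq : ‖q‖ < 1) : eulerE q ≠ 0 := by
  rw [eulerE_eq_qPoch]
  exact qPoch_ne_zero_of_norm_lt_one hq hq

theorem continuous_qPoch {q : ℂ} (hq : ‖q‖ < 1) : Continuous fun u => qPoch u q := by
  refine continuous_iff_continuousAt.2 fun u => ?_
  have := tendsto_tprod_one_add_of_dominated_convergence (𝓕 := 𝓝 u)
    (f := fun v (n : ℕ) => -(v * q ^ n)) (g := fun n : ℕ => -(u * q ^ n))
    (bound := fun n : ℕ => (‖u‖ + 1) * ‖q‖ ^ n) ?_ ?_ ?_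
  · simpa [ContinuousAt, qPoch, sub_eq_add_neg] using this
  · exact (summable_geometric_of_lt_one (norm_nonneg q) hq).mul_left _
  · intro n
    exact (tendsto_id.mul_const _).neg
  · have : ∀ᶠ v in 𝓝 u, ‖v‖ < ‖u‖ + 1 := continuous_norm.continuousAt.eventually_lt_const (by simp)
    filter_upwards [this] with v hv n
    rw [norm_neg, norm_mul, norm_pow]
    gcongr

theorem multipliable_bracketFactor {q : ℂ} (hq : ‖q‖ < 1) (z : ℂ) :
    Multipliable (bracketFactor z q) := by
  have := (multipliable_qPoch hq z).mul (multipliable_qPoch hq (z⁻¹ * q))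
  refine this.congr fun n => ?_
  simp [bracketFactor, pow_succ', mul_assoc]

theorem tprod_bracketFactor {q : ℂ} (hq : ‖q‖ < 1) (z : ℂ) :
    ∏' n, bracketFactor z q n = qPoch z q * qPoch (z⁻¹ * q) q := by
  rw [qPoch, qPoch, ← (multipliable_qPoch hq z).tprod_mul (multipliable_qPoch hq (z⁻¹ * q))]
  simp [bracketFactor, pow_succ', mul_assoc]

/-- The factors of the product are sorted by the residue of their index modulo a. -/
theorem prod_qPoch_mul_pow {a : ℕ} (ha : a ≠ 0) {q : ℂ} (hq : ‖q‖ < 1) (u : ℂ) :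
    ∏ i : Fin a, qPoch (u * q ^ (i : ℕ)) (q ^ a) = qPoch u q := by
  have : NeZero a := ⟨ha⟩
  have hqa : ‖q ^ a‖ < 1 := by
    rw [norm_pow]
    exact pow_lt_one₀ (norm_nonneg q) hq ha
  obtain ⟨e, he0⟩ : ∃ e : Fin a × ℕ ≃ ℕ, ∀ p, e p = p.2 * a + p.1 :=
    ⟨(Equiv.prodComm _ _).trans (Nat.divModEquiv a).symm, fun p => rfl⟩
  have he : ∀ p : Fin a × ℕ, 1 - u * q ^ (e p) = 1 - u * q ^ (p.1 : ℕ) * (q ^ a) ^ p.2 := by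
    intro p
    rw [he0, ← pow_mul, mul_assoc, ← pow_add]
    ring_nf
  have hm : Multipliable fun p : Fin a × ℕ => 1 - u * q ^ (p.1 : ℕ) * (q ^ a) ^ p.2 :=
    ((e.multipliable_iff).2 (multipliable_qPoch hq u)).congr he
  have h1 : qPoch u q = ∏' p : Fin a × ℕ, (1 - u * q ^ (p.1 : ℕ) * (q ^ a) ^ p.2) := by
    rw [qPoch, ← e.tprod_eq]
    exact tprod_congr he
  rw [h1, hm.tprod_prod' (fun i => multipliable_qPoch hqa (u * q ^ (i : ℕ))), tprod_fintype]
  simp only [qPoch]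

/-! ### Theta series and the Jacobi triple product -/

/-- The general term of the theta series `∑ (-1) ^ k q ^ (k (k - 1) / 2) z ^ k`. -/
noncomputable def thetaTerm (z q : ℂ) (k : ℤ) : ℂ :=
  (-1) ^ k * q ^ (k * (k - 1) / 2) * z ^ k

/-- The theta series `∑ (-1) ^ k q ^ (k (k - 1) / 2) z ^ k`. -/
noncomputable def thetaSeries (z q : ℂ) : ℂ := ∑' k : ℤ, thetaTerm z q k

theorem triangular_succ (k : ℤ) : (k + 1) * (k + 1 - 1) / 2 = k * (k - 1) / 2 + k := by
  rw [show (k + 1) * (k + 1 - 1) = k * (k - 1) + k * 2 by ring,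
    Int.add_mul_ediv_right _ _ two_ne_zero]

theorem thetaTerm_succ {z q : ℂ} (hz : z ≠ 0) (hq : q ≠ 0) (k : ℤ) :
    thetaTerm z q (k + 1) = -(q ^ k * z) * thetaTerm z q k := by
  rw [thetaTerm, thetaTerm, triangular_succ, zpow_add₀ hq, zpow_add_one₀ hz,
    zpow_add_one₀ (by norm_num)]
  ring

theorem thetaTerm_ne_zero {z q : ℂ} (hz : z ≠ 0) (hq : q ≠ 0) (k : ℤ) : thetaTerm z q k ≠ 0 :=
  mul_ne_zero (mul_ne_zero (zpow_ne_zero _ (by norm_num)) (zpow_ne_zero _ hq)) (zpow_ne_zero _ hz)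

theorem summable_norm_thetaTerm {z q : ℂ} (hz : z ≠ 0) (hq0 : q ≠ 0) (hq : ‖q‖ < 1) :
    Summable fun k : ℤ => ‖thetaTerm z q k‖ := by
  have hlim : ∀ c : ℝ, Tendsto (fun n : ℕ => ‖q‖ ^ n * c) atTop (𝓝 0) := fun c => by
    simpa using (tendsto_pow_atTop_nhds_zero_of_lt_one (norm_nonneg q) hq).mul_const c
  refine Summable.of_nat_of_neg ?_ ?_
  · refine summable_of_ratio_test_tendsto_lt_one zero_lt_one
      (.of_forall fun n => norm_ne_zero_iff.2 (thetaTerm_ne_zero hz hq0 _))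
      ((hlim ‖z‖).congr fun n => ?_)
    have h0 := norm_ne_zero_iff.2 (thetaTerm_ne_zero hz hq0 (n : ℤ))
    rw [norm_norm, norm_norm, eq_div_iff h0]
    push_cast
    rw [thetaTerm_succ hz hq0, norm_mul, norm_neg, norm_mul, zpow_natCast, norm_pow]
  · refine summable_of_ratio_test_tendsto_lt_one zero_lt_one
      (.of_forall fun n => norm_ne_zero_iff.2 (thetaTerm_ne_zero hz hq0 _))
      ((hlim (‖q‖ * ‖z‖⁻¹)).congr fun n => ?_)
    have h0 := norm_ne_zero_iff.2 (thetaTerm_ne_zero hz hq0 (-(n : ℤ)))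
    have hz' := norm_ne_zero_iff.2 hz
    have hq' := norm_ne_zero_iff.2 hq0
    have h := congrArg norm (thetaTerm_succ hz hq0 (-((n + 1 : ℕ) : ℤ)))
    rw [show -((n + 1 : ℕ) : ℤ) + 1 = -(n : ℤ) by push_cast; ring, norm_mul, norm_neg, norm_mul,
      zpow_neg, zpow_natCast, norm_inv, norm_pow] at h
    rw [norm_norm, norm_norm, eq_div_iff h0, h, pow_succ]
    field_simp

/-- The reciprocal of `(1 - q) ⋯ (1 - q ^ m)`, extended by zero to negative `m`. -/
noncomputable def qFactInv (q : ℂ) (m : ℤ) : ℂ :=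
  if m < 0 then 0 else (∏ i ∈ Finset.range m.toNat, (1 - q ^ (i + 1)))⁻¹

theorem one_sub_pow_succ_ne_zero {q : ℂ} (hq : ‖q‖ < 1) (i : ℕ) : 1 - q ^ (i + 1) ≠ 0 := by
  refine one_sub_ne_zero_of_norm_lt_one ?_
  rw [norm_pow]
  exact pow_lt_one₀ (norm_nonneg q) hq i.succ_ne_zero

/-- The extension by zero is consistent at m = -1 because 1 - q^0 = 0, so the recurrence has no
boundary cases. -/
theorem qFactInv_eq_mul_succ {q : ℂ} (hq : ‖q‖ < 1) (m : ℤ) :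
    qFactInv q m = (1 - q ^ (m + 1)) * qFactInv q (m + 1) := by
  rcases lt_trichotomy m (-1) with h | rfl | h
  · simp [qFactInv, show m < 0 by omega, show m + 1 < 0 by omega]
  · simp [qFactInv]
  · obtain ⟨n, rfl⟩ := Int.eq_ofNat_of_zero_le (show 0 ≤ m by omega)
    have h2 : ¬ ((n : ℤ) + 1 < 0) := by omega
    have h3 : ((n : ℤ) + 1).toNat = n + 1 := by omega
    have h4 := one_sub_pow_succ_ne_zero hq n
    simp only [qFactInv, h2, h3, if_false, Finset.prod_range_succ]
    rw [if_neg (by omega), Int.toNat_natCast, mul_inv, mul_comm, mul_assoc]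
    have h5 : q ^ ((n : ℤ) + 1) = q ^ (n + 1) := by exact_mod_cast zpow_natCast q (n + 1)
    rw [h5, inv_mul_cancel₀ h4, mul_one]

theorem tendsto_prod_eulerE {q : ℂ} (hq : ‖q‖ < 1) :
    Tendsto (fun n => ∏ i ∈ Finset.range n, (1 - q ^ (i + 1))) atTop (𝓝 (eulerE q)) := by
  have := (multipliable_qPoch hq q).hasProd.tendsto_prod_nat
  rw [← qPoch, ← eulerE_eq_qPoch] at this
  simpa [pow_succ'] using this

/-- The reciprocals converge since `eulerE q` is nonzero, hence are bounded; this dominates the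
finite triple product as n tends to infinity. -/
theorem exists_norm_qFactInv_le {q : ℂ} (hq : ‖q‖ < 1) :
    ∃ B : ℝ, ∀ m, ‖qFactInv q m‖ ≤ B := by
  obtain ⟨B, hB⟩ := (Metric.isBounded_range_of_tendsto _
    ((tendsto_prod_eulerE hq).inv₀ (eulerE_ne_zero hq))).exists_norm_le
  refine ⟨B, fun m => ?_⟩
  have h0 : 0 ≤ B := (norm_nonneg _).trans (hB _ ⟨0, rfl⟩)
  rw [qFactInv]
  split_ifs
  · simpa using h0
  · exact hB _ ⟨m.toNat, rfl⟩

theorem tendsto_qFactInv {q : ℂ} (hq : ‖q‖ < 1) :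
    Tendsto (qFactInv q) atTop (𝓝 (eulerE q)⁻¹) := by
  have h1 : Tendsto Int.toNat atTop atTop :=
    tendsto_atTop.2 fun n => by
      filter_upwards [eventually_ge_atTop (n : ℤ)] with m hm
      omega
  refine (((tendsto_prod_eulerE hq).inv₀ (eulerE_ne_zero hq)).comp h1).congr' ?_
  filter_upwards [eventually_ge_atTop (0 : ℤ)] with m hm
  simp [qFactInv, not_lt.2 hm]

/-- A finite form of the Jacobi triple product. -/
theorem hasSum_thetaTerm_mul_qFactInv {z q : ℂ} (hz : z ≠ 0) (hq0 : q ≠ 0) (hq : ‖q‖ < 1)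
    (n : ℕ) :
    HasSum (fun k : ℤ => thetaTerm z q k * (qFactInv q (n + k) * qFactInv q (n - k)))
      ((∏ i ∈ Finset.range n, bracketFactor z q i) *
        (∏ i ∈ Finset.range (2 * n), (1 - q ^ (i + 1)))⁻¹) := by
  induction n with
  | zero =>
    convert hasSum_single (0 : ℤ) ?_ using 1
    · simp [thetaTerm, qFactInv]
    · intro k hk
      rcases lt_or_gt_of_ne hk with h | h
      · simp [qFactInv, h]
      · simp [qFactInv, h]
  | succ n ih =>
    set D := (1 - q ^ (2 * n + 1)) * (1 - q ^ (2 * n + 1 + 1)) with hD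
    have hD0 : D ≠ 0 :=
      mul_ne_zero (one_sub_pow_succ_ne_zero hq _) (one_sub_pow_succ_ne_zero hq _)
    -- The new bracket factor is 1 + q^(2n+1) - z q^n - z⁻¹ q^(n+1); multiplication by z or z⁻¹ is
    -- matched by a shift of k.
    have hup := ((Equiv.subRight (1 : ℤ)).hasSum_iff.2 ih).mul_left (-(z * q ^ n))
    have hdown := ((Equiv.addRight (1 : ℤ)).hasSum_iff.2 ih).mul_left (-(z⁻¹ * q ^ (n + 1)))
    have key := (((ih.mul_left (1 + q ^ (2 * n + 1))).add hup).add hdown).mul_left D⁻¹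
    convert key using 1
    · rfl
    · funext k
      simp only [Function.comp, Equiv.subRight_apply, Equiv.coe_addRight]
      have t1 := thetaTerm_succ hz hq0 k
      have t2 := thetaTerm_succ hz hq0 (k - 1)
      have r1 := qFactInv_eq_mul_succ hq ((n : ℤ) + k)
      have r2 := qFactInv_eq_mul_succ hq ((n : ℤ) + k - 1)
      have r3 := qFactInv_eq_mul_succ hq ((n : ℤ) - k)
      have r4 := qFactInv_eq_mul_succ hq ((n : ℤ) - k - 1)
      rw [sub_add_cancel] at t2 r2 r4
      rw [show ((n + 1 : ℕ) : ℤ) + k = n + k + 1 by push_cast; ring,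
        show ((n + 1 : ℕ) : ℤ) - k = n - k + 1 by push_cast; ring,
        show (n : ℤ) + (k - 1) = n + k - 1 by ring, show (n : ℤ) - (k - 1) = n - k + 1 by ring,
        show (n : ℤ) + (k + 1) = n + k + 1 by ring, show (n : ℤ) - (k + 1) = n - k - 1 by ring,
        r2, r4, r1, r3, t1, t2]
      set T := thetaTerm z q (k - 1)
      set U := qFactInv q ((n : ℤ) + k + 1)
      set V := qFactInv q ((n : ℤ) - k + 1)
      have hx := zpow_ne_zero k hq0
      have hy := pow_ne_zero n hq0
      rw [zpow_add₀ hq0, zpow_add₀ hq0, zpow_sub₀ hq0, zpow_add₀ hq0, zpow_sub₀ hq0,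
        zpow_natCast, zpow_one, eq_inv_mul_iff_mul_eq₀ hD0, hD, pow_succ, pow_succ, pow_mul',
        pow_succ]
      set x := q ^ k
      set y := q ^ n
      field_simp
      ring
    · rw [Finset.prod_range_succ, show 2 * (n + 1) = 2 * n + 1 + 1 by ring,
        Finset.prod_range_succ _ (2 * n + 1), Finset.prod_range_succ _ (2 * n), mul_assoc _ _
          (1 - q ^ (2 * n + 1 + 1)), ← hD, mul_inv, bracketFactor]
      field_simp
      ring

/-- The Jacobi triple product identity. -/
theorem thetaSeries_eq {z q : ℂ} (hz : z ≠ 0) (hq0 : q ≠ 0) (hq : ‖q‖ < 1) :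
    thetaSeries z q = eulerE q * (qPoch z q * qPoch (z⁻¹ * q) q) := by
  have hE := eulerE_ne_zero hq
  obtain ⟨B, hB⟩ := exists_norm_qFactInv_le hq
  have hlim : Tendsto (fun n : ℕ =>
      ∑' k : ℤ, thetaTerm z q k * (qFactInv q (n + k) * qFactInv q (n - k))) atTop
      (𝓝 (∑' k : ℤ, thetaTerm z q k * ((eulerE q)⁻¹ * (eulerE q)⁻¹))) := by
    refine tendsto_tsum_of_dominated_convergence
      (bound := fun k => ‖thetaTerm z q k‖ * (B * B))
      ((summable_norm_thetaTerm hz hq0 hq).mul_right _) (fun k => ?_) (.of_forall fun n k => ?_)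
    · refine Tendsto.const_mul _ (Tendsto.mul ?_ ?_)
      · exact (tendsto_qFactInv hq).comp
          (tendsto_atTop_add_const_right _ k tendsto_natCast_atTop_atTop)
      · simp only [sub_eq_add_neg]
        exact (tendsto_qFactInv hq).comp
          (tendsto_atTop_add_const_right _ (-k) tendsto_natCast_atTop_atTop)
    · rw [norm_mul, norm_mul]
      have := (norm_nonneg _).trans (hB 0)
      gcongr <;> exact hB _
  have hlim2 : Tendsto (fun n : ℕ => (∏ i ∈ Finset.range n, bracketFactor z q i) *
      (∏ i ∈ Finset.range (2 * n), (1 - q ^ (i + 1)))⁻¹) atTop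
      (𝓝 ((∏' n, bracketFactor z q n) * (eulerE q)⁻¹)) :=
    (multipliable_bracketFactor hq z).hasProd.tendsto_prod_nat.mul
      (((tendsto_prod_eulerE hq).comp (tendsto_id.const_mul_atTop' two_pos)).inv₀ hE)
  have := tendsto_nhds_unique hlim
    (hlim2.congr fun n => (hasSum_thetaTerm_mul_qFactInv hz hq0 hq n).tsum_eq.symm)
  rw [tsum_mul_right, ← thetaSeries, tprod_bracketFactor hq] at this
  rw [← mul_left_inj' (mul_ne_zero (inv_ne_zero hE) (inv_ne_zero hE)), this]
  field_simp

theorem thetaTerm_mul (u z q : ℂ) (k : ℤ) : thetaTerm (u * z) q k = thetaTerm u q k * z ^ k := by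
  rw [thetaTerm, thetaTerm, mul_zpow]
  ring

/-! ### Quasi-periodic Laurent series -/

/-- The sum of the weights over a fibre of the degree `M`. -/
noncomputable def fiberSum {Y : Type*} (w : Y → ℂ) (M : Y → ℤ) (N : ℤ) : ℂ :=
  ∑' y : M ⁻¹' {N}, w y

section QuasiPeriodic

variable {Y : Type*} {w : Y → ℂ} {M : Y → ℤ} {Φ : Y ≃ Y} {a : ℕ} {q z : ℂ}

/-- Φ carries the fibre over N bijectively onto that over N + a and scales all its weights by the
same -q^N, so no summability is needed. -/
theorem fiberSum_add (hM : ∀ y, M (Φ y) = M y + a) (hw : ∀ y, w (Φ y) = -(q ^ M y) * w y)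
    (N : ℤ) : fiberSum w M (N + a) = -(q ^ N) * fiberSum w M N := by
  let e : M ⁻¹' {N} ≃ M ⁻¹' {N + (a : ℤ)} := Φ.subtypeEquiv fun y => by simp [hM]
  rw [fiberSum, fiberSum, ← e.tsum_eq, ← tsum_mul_left]
  refine tsum_congr fun y => ?_
  have h1 : ((e y : M ⁻¹' {N + (a : ℤ)}) : Y) = Φ y := rfl
  have h2 : M y = N := y.2
  rw [h1, hw, h2]

/-- Both sides obey the same first-order recurrence in m; its factor is nonzero, so it also runs
backwards. -/
theorem fiberSum_add_mul (hq0 : q ≠ 0) (hM : ∀ y, M (Φ y) = M y + a)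
    (hw : ∀ y, w (Φ y) = -(q ^ M y) * w y) (j : ℕ) (m : ℤ) :
    fiberSum w M (j + m * a) = thetaTerm (q ^ j) (q ^ a) m * fiberSum w M j := by
  have hj : q ^ j ≠ 0 := pow_ne_zero _ hq0
  have ha : q ^ a ≠ 0 := pow_ne_zero _ hq0
  have hstep : ∀ m : ℤ, fiberSum w M (j + (m + 1) * a) =
      -((q ^ a) ^ m * q ^ j) * fiberSum w M (j + m * a) := by
    intro m
    rw [show (j : ℤ) + (m + 1) * a = j + m * a + a by ring, fiberSum_add hM hw, zpow_add₀ hq0,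
      zpow_natCast, mul_comm m, zpow_mul, zpow_natCast]
    ring
  induction m using Int.induction_on with
  | zero => simp [thetaTerm]
  | succ m ih => rw [hstep, ih, thetaTerm_succ hj ha, mul_assoc]
  | pred m ih =>
    have h1 := hstep (-(m : ℤ) - 1)
    have h2 := thetaTerm_succ hj ha (-(m : ℤ) - 1)
    rw [sub_add_cancel] at h1 h2
    rw [ih, h2, mul_assoc] at h1
    exact (mul_left_cancel₀ (neg_ne_zero.2 (mul_ne_zero (zpow_ne_zero _ ha) hj)) h1).symm

/-- A Laurent series whose coefficients satisfy `c (N + a) = -q ^ N c N` is a combination of `a`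
theta series. -/
theorem tsum_eq_sum_thetaSeries (ha : a ≠ 0) (hq0 : q ≠ 0) (hz : z ≠ 0)
    (hM : ∀ y, M (Φ y) = M y + a) (hw : ∀ y, w (Φ y) = -(q ^ M y) * w y)
    (hs : Summable fun y => w y * z ^ M y) :
    ∑' y, w y * z ^ M y =
      ∑ j : Fin a, fiberSum w M (j : ℕ) * z ^ (j : ℕ) * thetaSeries (q ^ (j : ℕ) * z ^ a) (q ^ a) := by
  have : NeZero a := ⟨ha⟩
  have h1 : HasSum (fun N : ℤ => fiberSum w M N * z ^ N) (∑' y, w y * z ^ M y) := by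
    refine (hs.hasSum.tsum_fiberwise M).congr_fun ?_
    intro N
    rw [fiberSum, ← tsum_mul_right]
    refine tsum_congr fun y => ?_
    have h2 : M y = N := y.2
    rw [h2]
  obtain ⟨e, he⟩ : ∃ e : Fin a × ℤ ≃ ℤ, ∀ p, e p = (p.1 : ℕ) + p.2 * a :=
    ⟨(Equiv.prodComm _ _).trans (Int.divModEquiv a).symm, fun p => by
      simp [Int.divModEquiv]; ring⟩
  have h3 : HasSum (fun p : Fin a × ℤ => fiberSum w M (p.1 : ℕ) * z ^ (p.1 : ℕ) *
      thetaTerm (q ^ (p.1 : ℕ) * z ^ a) (q ^ a) p.2) (∑' y, w y * z ^ M y) := by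
    refine (e.hasSum_iff.2 h1).congr_fun ?_
    intro p
    rw [Function.comp, he, fiberSum_add_mul hq0 hM hw, thetaTerm_mul, zpow_add₀ hz, mul_comm p.2,
      zpow_mul, zpow_natCast, zpow_natCast]
    ring
  rw [← h3.tsum_eq, h3.summable.tsum_prod, tsum_fintype]
  simp only [tsum_mul_left, thetaSeries]

end QuasiPeriodic

/-! ### Weights on ℤ^a and the generating function of a-cores -/

theorem summable_norm_prod_and_tsum_prod {β : Type*} {a : ℕ} (f : Fin a → β → ℂ)
    (hf : ∀ i, Summable fun b => ‖f i b‖) :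
    (Summable fun n : Fin a → β => ‖∏ i, f i (n i)‖) ∧
      ∑' n : Fin a → β, ∏ i, f i (n i) = ∏ i, ∑' b, f i b := by
  induction a with
  | zero => exact ⟨(hasSum_fintype _).summable, by simp [tsum_fintype]⟩
  | succ a ih =>
    obtain ⟨h1, h2⟩ := ih (fun i => f i.succ) fun i => hf _
    let e := Fin.consEquiv fun _ : Fin (a + 1) => β
    have he : ∀ p : β × (Fin a → β), ∏ i, f i (e p i) = f 0 p.1 * ∏ i : Fin a, f i.succ (p.2 i) := by
      intro p
      simp [e, Fin.prod_univ_succ, Fin.consEquiv]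
    constructor
    · rw [← e.summable_iff]
      refine (Summable.mul_norm (hf 0) h1).congr fun p => ?_
      rw [Function.comp, he]
    · rw [← e.tsum_eq, Fin.prod_univ_succ, ← h2, tsum_mul_tsum_of_summable_norm (hf 0) h1]
      exact tsum_congr he

theorem zpow_sum_eq_prod {a : ℕ} {z : ℂ} (hz : z ≠ 0) (f : Fin a → ℤ) :
    z ^ ∑ i, f i = ∏ i, z ^ f i := by
  have : ∀ s : Finset (Fin a), z ^ ∑ i ∈ s, f i = ∏ i ∈ s, z ^ f i := by
    intro s
    induction s using Finset.cons_induction with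
    | empty => simp
    | cons i s hi ih => rw [Finset.prod_cons, Finset.sum_cons, zpow_add₀ hz, ih]
  exact this _

/-- The weight `(-1) ^ (∑ n_i) q ^ (∑ (a n_i (n_i - 1) / 2 + i n_i))` on `ℤ ^ a`. -/
noncomputable def coreWeight (a : ℕ) (q : ℂ) (n : Fin a → ℤ) : ℂ :=
  ∏ i : Fin a, thetaTerm (q ^ (i : ℕ)) (q ^ a) (n i)

/-- On vectors of sum zero the signs cancel, and so do the linear parts of n_i (n_i - 1) / 2. -/
theorem coreWeight_eq_zpow_coreExponent {a : ℕ} {q : ℂ} (hq0 : q ≠ 0) {n : Fin a → ℤ}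
    (hn : ∑ i, n i = 0) : coreWeight a q n = q ^ coreExponent a n := by
  have h1 : ∀ i : Fin a, thetaTerm (q ^ (i : ℕ)) (q ^ a) (n i) =
      (-1) ^ n i * q ^ ((a : ℤ) * (n i * (n i - 1) / 2) + (i : ℕ) * n i) := by
    intro i
    rw [thetaTerm, zpow_add₀ hq0, zpow_mul, zpow_mul, zpow_natCast, zpow_natCast, mul_assoc]
  have h4 : ∑ i, ((a : ℤ) * (n i * (n i - 1) / 2) + (i : ℕ) * n i) = coreExponent a n := by
    have h5 := two_mul_coreExponent a n hn
    have h6 : ∀ i, 2 * (n i * (n i - 1) / 2) = n i * n i - n i := fun i => by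
      rw [Int.mul_ediv_cancel' (Int.even_mul_pred_self _).two_dvd]
      ring
    have h7 : 2 * ∑ i, ((a : ℤ) * (n i * (n i - 1) / 2) + (i : ℕ) * n i) =
        (a : ℤ) * ∑ i, (n i * n i - n i) + 2 * ∑ i : Fin a, ((i : ℕ) : ℤ) * n i := by
      simp only [Finset.mul_sum, ← Finset.sum_add_distrib]
      refine Finset.sum_congr rfl fun i _ => ?_
      rw [← h6]
      ring
    rw [Finset.sum_sub_distrib, hn, sub_zero] at h7
    omega
  rw [coreWeight, Finset.prod_congr rfl fun i _ => h1 i, Finset.prod_mul_distrib,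
    ← zpow_sum_eq_prod (by norm_num), ← zpow_sum_eq_prod hq0, hn, h4, zpow_zero, one_mul]

/-- The shift `(n_0, …, n_{a-1}) ↦ (n_{a-1} + 1, n_0, …, n_{a-2})`. -/
def cyclicShift (b : ℕ) : (Fin (b + 1) → ℤ) ≃ (Fin (b + 1) → ℤ) where
  toFun n := Fin.cons (n (Fin.last b) + 1) fun i => n i.castSucc
  invFun n := Fin.snoc (α := fun _ => ℤ) (fun i => n i.succ) (n 0 - 1)
  left_inv n := by
    funext i
    refine Fin.lastCases ?_ (fun i => ?_) i <;> simp
  right_inv n := by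
    funext i
    refine Fin.cases ?_ (fun i => ?_) i <;> simp

theorem cyclicShift_zero {b : ℕ} (n : Fin (b + 1) → ℤ) :
    cyclicShift b n 0 = n (Fin.last b) + 1 := rfl

theorem cyclicShift_succ {b : ℕ} (n : Fin (b + 1) → ℤ) (i : Fin b) :
    cyclicShift b n i.succ = n i.castSucc := rfl

theorem sum_cyclicShift {b : ℕ} (n : Fin (b + 1) → ℤ) :
    ∑ i, cyclicShift b n i = ∑ i, n i + 1 := by
  rw [Fin.sum_univ_succ, Fin.sum_univ_castSucc n]
  simp only [cyclicShift_zero, cyclicShift_succ]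
  ring

/-- An entry k moving from position i to i + 1 gains q^k; the last one returns to position 0 as k +
1 and gains -q^k by the recurrence of the theta terms. -/
theorem coreWeight_cyclicShift {b : ℕ} {q : ℂ} (hq0 : q ≠ 0) (n : Fin (b + 1) → ℤ) :
    coreWeight (b + 1) q (cyclicShift b n) = -(q ^ ∑ i, n i) * coreWeight (b + 1) q n := by
  have h1 : ∀ (i : ℕ) (k : ℤ), thetaTerm (q ^ (i + 1)) (q ^ (b + 1)) k =
      thetaTerm (q ^ i) (q ^ (b + 1)) k * q ^ k := fun i k => by rw [pow_succ, thetaTerm_mul]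
  have h2 : ∀ k : ℤ, thetaTerm (q ^ 0) (q ^ (b + 1)) (k + 1) =
      -(q ^ k) * thetaTerm (q ^ b) (q ^ (b + 1)) k := fun k => by
    have := thetaTerm_mul 1 (q ^ b) (q ^ (b + 1)) k
    rw [one_mul] at this
    rw [pow_zero, thetaTerm_succ one_ne_zero (pow_ne_zero _ hq0), this, pow_succ, mul_zpow]
    ring
  rw [coreWeight, coreWeight, Fin.prod_univ_succ, Fin.prod_univ_castSucc, Fin.sum_univ_castSucc,
    zpow_add₀ hq0, zpow_sum_eq_prod hq0]
  simp only [cyclicShift_zero, cyclicShift_succ, Fin.val_zero, Fin.val_succ, Fin.val_castSucc,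
    Fin.val_last, h1, h2, Finset.prod_mul_distrib]
  ring

theorem norm_pow_lt_one {q : ℂ} (hq : ‖q‖ < 1) {a : ℕ} (ha : a ≠ 0) : ‖q ^ a‖ < 1 := by
  rw [norm_pow]
  exact pow_lt_one₀ (norm_nonneg q) hq ha

/-- Supplies a point at which the product common to both sides of `tsum_coreExponent` can be
cancelled. -/
theorem exists_qPoch_ne_zero {q : ℂ} (hq : ‖q‖ < 1) :
    ∃ z : ℂ, z ≠ 0 ∧ qPoch z q ≠ 0 ∧ qPoch (z⁻¹ * q) q ≠ 0 := by
  refine ⟨-1, by norm_num, qPoch_ne_zero hq fun n => ?_, ?_⟩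
  · rw [neg_one_mul, sub_neg_eq_add]
    rcases eq_or_ne n 0 with rfl | hn
    · norm_num
    · have := one_sub_ne_zero_of_norm_lt_one (u := -q ^ n) (by simpa using norm_pow_lt_one hq hn)
      simpa using this
  · exact qPoch_ne_zero_of_norm_lt_one hq (by simpa [norm_mul] using hq)

/-- The generating function of `a`-cores. -/
theorem tsum_coreExponent {a : ℕ} (ha : a ≠ 0) {q : ℂ} (hq0 : q ≠ 0) (hq : ‖q‖ < 1) :
    (∑' n : ZeroSumLattice a, q ^ coreExponent a n.1) * eulerE q = eulerE (q ^ a) ^ a := by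
  obtain ⟨b, rfl⟩ : ∃ b, a = b + 1 := Nat.exists_eq_succ_of_ne_zero ha
  obtain ⟨z, hz, hz1, hz2⟩ := exists_qPoch_ne_zero hq
  have hqa0 := pow_ne_zero (b + 1) hq0
  have hqa := norm_pow_lt_one hq ha
  have hzi : ∀ i : ℕ, q ^ i * z ≠ 0 := fun i => mul_ne_zero (pow_ne_zero _ hq0) hz
  obtain ⟨h1, h2⟩ := summable_norm_prod_and_tsum_prod
    (fun (i : Fin (b + 1)) k => thetaTerm (q ^ (i : ℕ) * z) (q ^ (b + 1)) k)
    fun i => summable_norm_thetaTerm (hzi i) hqa0 hqa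
  have h3 : ∀ n : Fin (b + 1) → ℤ, ∏ i : Fin (b + 1), thetaTerm (q ^ (i : ℕ) * z) (q ^ (b + 1)) (n i) =
      coreWeight (b + 1) q n * z ^ ∑ i, n i := by
    intro n
    rw [coreWeight, zpow_sum_eq_prod hz, ← Finset.prod_mul_distrib]
    exact Finset.prod_congr rfl fun i _ => thetaTerm_mul _ _ _ _
  -- Graded by the sum of the entries, the cyclic shift has period 1, so the product of thetas is a
  -- single multiple of θ(z;q), whose coefficient is the sum over the lattice.
  have h4 := tsum_eq_sum_thetaSeries (w := coreWeight (b + 1) q) (M := fun n => ∑ i, n i)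
    (Φ := cyclicShift b) (a := 1) (z := z) one_ne_zero hq0 hz
    (fun n => by simpa using sum_cyclicShift n) (coreWeight_cyclicShift hq0)
    (h1.of_norm.congr h3)
  rw [← tsum_congr h3, h2] at h4
  change ∏ i : Fin (b + 1), thetaSeries (q ^ (i : ℕ) * z) (q ^ (b + 1)) = _ at h4
  have h5 : fiberSum (coreWeight (b + 1) q) (fun n => ∑ i, n i) 0 =
      ∑' n : ZeroSumLattice (b + 1), q ^ coreExponent (b + 1) n.1 :=
    tsum_congr fun n => coreWeight_eq_zpow_coreExponent hq0 n.2
  have h6 : ∏ i : Fin (b + 1), qPoch (q ^ (i : ℕ) * z) (q ^ (b + 1)) = qPoch z q := by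
    rw [← prod_qPoch_mul_pow ha hq z]
    exact Finset.prod_congr rfl fun i _ => by rw [mul_comm]
  have h7 : ∏ i : Fin (b + 1), qPoch ((q ^ (i : ℕ) * z)⁻¹ * q ^ (b + 1)) (q ^ (b + 1)) =
      qPoch (z⁻¹ * q) q := by
    -- Inverting q^i z reverses the residues: q^(b+1-i) = q · q^(b-i).
    rw [← prod_qPoch_mul_pow ha hq, ← Equiv.prod_comp Fin.revPerm]
    refine Finset.prod_congr rfl fun i _ => ?_
    congr 1
    have h8 : q ^ (b + 1) = q ^ ((Fin.rev i : Fin (b + 1)) : ℕ) * (q * q ^ (i : ℕ)) := by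
      rw [← pow_succ', ← pow_add, Fin.val_rev]
      congr 1
      omega
    rw [Fin.revPerm_apply, h8]
    have := pow_ne_zero ((Fin.rev i : Fin (b + 1)) : ℕ) hq0
    field_simp
  simp only [thetaSeries_eq (hzi _) hqa0 hqa, Finset.prod_mul_distrib, h6, h7, Finset.prod_const,
    Finset.card_univ, Fintype.card_fin] at h4
  simp only [Finset.univ_unique, Finset.sum_singleton, Fin.default_eq_zero, Fin.val_zero, pow_zero,
    pow_one, one_mul, mul_one, thetaSeries_eq hz hq0 hq] at h4
  rw [Nat.cast_zero, h5] at h4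
  refine mul_right_cancel₀ (mul_ne_zero hz1 hz2) ?_
  linear_combination -h4

/-! ### Shift symmetry and absolute convergence of C_a -/

theorem coreWeight_add_single {a : ℕ} {q : ℂ} (hq0 : q ≠ 0) (k : Fin a → ℤ) (j : Fin a) :
    coreWeight a q (k + Pi.single j 1) =
      -((q ^ a) ^ k j * q ^ (j : ℕ)) * coreWeight a q k := by
  rw [coreWeight, coreWeight, ← Finset.mul_prod_erase _ _ (Finset.mem_univ j),
    ← Finset.mul_prod_erase _ _ (Finset.mem_univ j), Pi.add_apply, Pi.single_eq_same,
    thetaTerm_succ (pow_ne_zero _ hq0) (pow_ne_zero _ hq0), mul_assoc]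
  congr 2
  refine Finset.prod_congr rfl fun i hi => ?_
  rw [Pi.add_apply, Pi.single_eq_of_ne (Finset.ne_of_mem_erase hi), add_zero]

/-- The exponent of `z` in the monomial of `C_a(z; q)` with index `(j, n)`. -/
def coreDegree {a : ℕ} (p : Fin a × ZeroSumLattice a) : ℤ := (a : ℤ) * p.2.1 p.1 + (p.1 : ℕ)

/-- The self-equivalence `(j, n) ↦ (j + 1, σ (n - e_j))` with `σ` the cyclic shift. -/
def coreShift (b : ℕ) :
    Fin (b + 1) × ZeroSumLattice (b + 1) ≃ Fin (b + 1) × ZeroSumLattice (b + 1) :=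
  Equiv.prodShear (finRotate (b + 1)) fun j =>
    ((Equiv.subRight (Pi.single j (1 : ℤ))).trans (cyclicShift b)).subtypeEquiv fun n => by
      simp [sum_cyclicShift, Finset.sum_sub_distrib]

theorem coe_coreShift_snd {b : ℕ} (p : Fin (b + 1) × ZeroSumLattice (b + 1)) :
    (coreShift b p).2.1 = cyclicShift b (p.2.1 - Pi.single p.1 1) := rfl

theorem coreShift_fst {b : ℕ} (p : Fin (b + 1) × ZeroSumLattice (b + 1)) :
    (coreShift b p).1 = finRotate (b + 1) p.1 := rfl

theorem coreDegree_coreShift {b : ℕ} (p : Fin (b + 1) × ZeroSumLattice (b + 1)) :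
    coreDegree (coreShift b p) = coreDegree p - b := by
  obtain ⟨j, n⟩ := p
  rw [coreDegree, coreDegree, coe_coreShift_snd, coreShift_fst]
  refine Fin.lastCases ?_ (fun i => ?_) j
  · rw [finRotate_last, cyclicShift_zero]
    simp
  · have : finRotate (b + 1) i.castSucc = i.succ := by simp
    rw [this, cyclicShift_succ]
    simp
    ring

/-- The path from n to σ(n - e_j) passes through a vector of sum -1, so the weight is used off the
lattice. -/
theorem zpow_coreExponent_coreShift {b : ℕ} {q : ℂ} (hq0 : q ≠ 0)
    (p : Fin (b + 1) × ZeroSumLattice (b + 1)) :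
    q ^ coreExponent (b + 1) p.2.1 =
      q ^ coreDegree (coreShift b p) * q ^ coreExponent (b + 1) (coreShift b p).2.1 := by
  rw [← coreWeight_eq_zpow_coreExponent hq0 p.2.2,
    ← coreWeight_eq_zpow_coreExponent hq0 (coreShift b p).2.2, coe_coreShift_snd,
    coreWeight_cyclicShift hq0, coreDegree_coreShift]
  have hsum : ∑ i, (p.2.1 - Pi.single p.1 1 : Fin (b + 1) → ℤ) i = -1 := by
    simp [Finset.sum_sub_distrib, p.2.2]
  have hw := coreWeight_add_single hq0 (p.2.1 - Pi.single p.1 1) p.1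
  rw [sub_add_cancel] at hw
  rw [hw, hsum, coreDegree]
  have h1 : (q ^ (b + 1)) ^ (p.2.1 - Pi.single p.1 1 : Fin (b + 1) → ℤ) p.1 * q ^ (p.1 : ℕ) =
      q ^ (((b + 1 : ℕ) : ℤ) * p.2.1 p.1 + (p.1 : ℕ) - b) * q ^ (-1 : ℤ) := by
    rw [← zpow_natCast q (b + 1), ← zpow_natCast q (p.1 : ℕ), ← zpow_mul, ← zpow_add₀ hq0,
      ← zpow_add₀ hq0]
    congr 1
    simp
    ring
  rw [h1]
  ring

/-- For fixed j, z^(a n_j) is absorbed into the j-th theta factor; what results is a subseries of an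
absolutely convergent product of theta series. -/
theorem summable_norm_coreMonomial {a : ℕ} (ha : a ≠ 0) {z q : ℂ} (hz : z ≠ 0) (hq0 : q ≠ 0)
    (hq : ‖q‖ < 1) :
    Summable fun p : Fin a × ZeroSumLattice a =>
      ‖q ^ coreExponent a p.2.1 * z ^ coreDegree p‖ := by
  rw [summable_prod_of_nonneg fun _ => norm_nonneg _]
  refine ⟨fun j => ?_, (hasSum_fintype _).summable⟩
  have h1 := (summable_norm_prod_and_tsum_prod
    (fun (i : Fin a) k => thetaTerm (q ^ (i : ℕ) * if i = j then z ^ a else 1) (q ^ a) k)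
    fun i => summable_norm_thetaTerm (mul_ne_zero (pow_ne_zero _ hq0)
      (by split_ifs <;> simp [hz])) (pow_ne_zero _ hq0) (norm_pow_lt_one hq ha)).1
  refine ((h1.subtype {n | ∑ i, n i = 0}).mul_right ‖z ^ (j : ℕ)‖).congr fun n => ?_
  rw [Function.comp, ← norm_mul]
  congr 1
  rw [← coreWeight_eq_zpow_coreExponent hq0 n.2, coreDegree, zpow_add₀ hz, zpow_natCast, zpow_mul,
    ← mul_assoc, coreWeight]
  simp only [thetaTerm_mul, Finset.prod_mul_distrib]
  congr 2
  rw [Finset.prod_eq_single j (fun i _ hi => by simp [hi]) (by simp), if_pos rfl, zpow_natCast]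

theorem coreThetaTerm_eq_sum {a : ℕ} (z q : ℂ) (n : ZeroSumLattice a) :
    coreThetaTerm a z q n = ∑ j : Fin a, q ^ coreExponent a n.1 * z ^ coreDegree (j, n) := by
  rw [coreThetaTerm, Finset.mul_sum]
  rfl

theorem summable_coreThetaTerm {a : ℕ} (ha : a ≠ 0) {z q : ℂ} (hz : z ≠ 0) (hq0 : q ≠ 0)
    (hq : ‖q‖ < 1) : Summable (coreThetaTerm a z q) := by
  have h := (summable_norm_coreMonomial ha hz hq0 hq).of_norm
  exact (summable_sum (s := Finset.univ) fun j _ => h.prod_factor j).congr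
    fun n => (coreThetaTerm_eq_sum z q n).symm

theorem coreTheta_eq_tsum {a : ℕ} (ha : a ≠ 0) {z q : ℂ} (hz : z ≠ 0) (hq0 : q ≠ 0)
    (hq : ‖q‖ < 1) : coreTheta a z q =
      ∑' p : Fin a × ZeroSumLattice a, q ^ coreExponent a p.2.1 * z ^ coreDegree p := by
  have h := (summable_norm_coreMonomial ha hz hq0 hq).of_norm
  rw [h.tsum_prod, tsum_fintype, coreTheta, tsum_congr fun n => coreThetaTerm_eq_sum z q n,
    Summable.tsum_finsetSum fun j _ => h.prod_factor j]

/-! ### Roots of unity and reduction to one theta series -/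

theorem coreTheta_eq_zero_of_pow_eq_one {a : ℕ} {z q : ℂ} (hz : z ^ a = 1) (hz1 : z ≠ 1) :
    coreTheta a z q = 0 := by
  have h : ∀ n : ZeroSumLattice a, coreThetaTerm a z q n = 0 := by
    intro n
    rcases eq_or_ne a 0 with rfl | ha
    · simp [coreThetaTerm]
    have hz0 : z ≠ 0 := by
      rintro rfl
      simp [ha] at hz
    have h1 : ∀ j : Fin a, z ^ ((a : ℤ) * n.1 j + ((j : ℕ) : ℤ)) = z ^ (j : ℕ) := fun j => by
      rw [zpow_add₀ hz0, zpow_mul, zpow_natCast, hz, one_zpow, one_mul, zpow_natCast]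
    rw [coreThetaTerm, Finset.sum_congr rfl fun j _ => h1 j, Fin.sum_univ_eq_sum_range,
      geom_sum_eq hz1, hz, sub_self, zero_div, mul_zero]
  rw [coreTheta, tsum_congr h, tsum_zero]

theorem coreTheta_one {a : ℕ} (q : ℂ) :
    coreTheta a 1 q = a * ∑' n : ZeroSumLattice a, q ^ coreExponent a n.1 := by
  rw [coreTheta, ← tsum_mul_left]
  refine tsum_congr fun n => ?_
  simp [coreThetaTerm, mul_comm]

theorem exists_coreTheta_mul_thetaSeries_eq_sum {a : ℕ} (ha : a ≠ 0) {q : ℂ} (hq0 : q ≠ 0)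
    (hq : ‖q‖ < 1) : ∃ h : Fin a → ℂ, ∀ z : ℂ, z ≠ 0 → coreTheta a z q * thetaSeries z q =
      ∑ j : Fin a, h j * z ^ (j : ℕ) * thetaSeries (q ^ (j : ℕ) * z ^ a) (q ^ a) := by
  obtain ⟨b, rfl⟩ : ∃ b, a = b + 1 := Nat.exists_eq_succ_of_ne_zero ha
  let w : (Fin (b + 1) × ZeroSumLattice (b + 1)) × ℤ → ℂ := fun y =>
    q ^ coreExponent (b + 1) y.1.2.1 * thetaTerm 1 q y.2
  let M : (Fin (b + 1) × ZeroSumLattice (b + 1)) × ℤ → ℤ := fun y => coreDegree y.1 + y.2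
  -- Ψ lowers the total degree by a: `coreShift` accounts for a - 1 and the theta index for 1. Its
  -- inverse is the shift that raises degrees.
  let Ψ := (coreShift b).prodCongr (Equiv.subRight (1 : ℤ))
  have hM : ∀ y, M y = M (Ψ y) + (b + 1 : ℕ) := by
    intro y
    simp [M, Ψ, coreDegree_coreShift]
    ring
  have hw : ∀ y, w y = -(q ^ M (Ψ y)) * w (Ψ y) := by
    intro y
    have h1 := thetaTerm_succ one_ne_zero hq0 (y.2 - 1)
    rw [sub_add_cancel, mul_one] at h1
    simp only [w, M, Ψ, Equiv.prodCongr_apply, Prod.map, Equiv.subRight_apply]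
    rw [zpow_coreExponent_coreShift hq0 y.1, h1, zpow_add₀ hq0]
    ring
  refine ⟨fun j => fiberSum w M (j : ℕ), fun z hz => ?_⟩
  have hn := summable_norm_coreMonomial ha hz hq0 hq
  have ht := summable_norm_thetaTerm hz hq0 hq
  have hterm : ∀ y, (q ^ coreExponent (b + 1) y.1.2.1 * z ^ coreDegree y.1) * thetaTerm z q y.2 =
      w y * z ^ M y := by
    intro y
    have := thetaTerm_mul 1 z q y.2
    rw [one_mul] at this
    simp only [w, M]
    rw [this, zpow_add₀ hz]
    ring
  rw [coreTheta_eq_tsum ha hz hq0 hq, thetaSeries, tsum_mul_tsum_of_summable_norm hn ht,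
    tsum_congr hterm]
  refine tsum_eq_sum_thetaSeries (Φ := Ψ.symm) ha hq0 hz (fun y => ?_) (fun y => ?_)
    ((summable_mul_of_summable_norm hn ht).congr hterm)
  · simpa using hM (Ψ.symm y)
  · simpa using hw (Ψ.symm y)

/-- Both j and a - j are positive, so the arguments q^j and q^(a-j) of the two products lie in the
unit disc. -/
theorem thetaSeries_pow_ne_zero {a j : ℕ} (hj0 : j ≠ 0) (hj : j < a) {q : ℂ} (hq0 : q ≠ 0)
    (hq : ‖q‖ < 1) : thetaSeries (q ^ j) (q ^ a) ≠ 0 := by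
  have ha : a ≠ 0 := by omega
  have hqa := norm_pow_lt_one hq ha
  rw [thetaSeries_eq (pow_ne_zero _ hq0) (pow_ne_zero _ hq0) hqa]
  refine mul_ne_zero (eulerE_ne_zero hqa)
    (mul_ne_zero (qPoch_ne_zero_of_norm_lt_one hqa (norm_pow_lt_one hq hj0))
      (qPoch_ne_zero_of_norm_lt_one hqa ?_))
  rw [← div_eq_inv_mul, div_eq_mul_inv, ← pow_sub₀ _ hq0 hj.le]
  exact norm_pow_lt_one hq (by omega)

theorem thetaSeries_one {q : ℂ} (hq0 : q ≠ 0) (hq : ‖q‖ < 1) : thetaSeries 1 q = 0 := by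
  rw [thetaSeries_eq one_ne_zero hq0 hq, qPoch_eq_one_sub_mul hq]
  ring

theorem exists_coreTheta_mul_thetaSeries {a : ℕ} (ha : a ≠ 0) {q : ℂ} (hq0 : q ≠ 0)
    (hq : ‖q‖ < 1) : ∃ c : ℂ, ∀ z : ℂ, z ≠ 0 →
      coreTheta a z q * thetaSeries z q = c * thetaSeries (z ^ a) (q ^ a) := by
  have : NeZero a := ⟨ha⟩
  obtain ⟨h, hh⟩ := exists_coreTheta_mul_thetaSeries_eq_sum ha hq0 hq
  have hζ := Complex.isPrimitiveRoot_exp a ha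
  set ζ := Complex.exp (2 * Real.pi * Complex.I / a)
  -- At z = ζ^i one has z^a = 1, so the theta factors no longer depend on i, leaving a Vandermonde
  -- system with distinct nodes.
  have hv : (fun j : Fin a => h j * thetaSeries (q ^ (j : ℕ)) (q ^ a)) = 0 := by
    refine Matrix.eq_zero_of_forall_index_sum_pow_mul_eq_zero (f := fun i : Fin a => ζ ^ (i : ℕ))
      (fun i j hij => Fin.ext (hζ.pow_inj i.2 j.2 hij)) fun i => ?_
    have hia : (ζ ^ (i : ℕ)) ^ a = 1 := by rw [← pow_mul, mul_comm, pow_mul, hζ.pow_eq_one, one_pow]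
    have h0 : coreTheta a (ζ ^ (i : ℕ)) q * thetaSeries (ζ ^ (i : ℕ)) q = 0 := by
      rcases eq_or_ne (ζ ^ (i : ℕ)) 1 with h1 | h1
      · rw [h1, thetaSeries_one hq0 hq, mul_zero]
      · rw [coreTheta_eq_zero_of_pow_eq_one hia h1, zero_mul]
    rw [hh _ (pow_ne_zero _ (Complex.exp_ne_zero _))] at h0
    rw [← h0]
    refine Finset.sum_congr rfl fun j _ => ?_
    rw [hia, mul_one]
    ring
  refine ⟨h 0, fun z hz => ?_⟩
  rw [hh z hz, Finset.sum_eq_single 0 (fun j _ hj => ?_) (by simp)]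
  · simp
  · have h1 := congrFun hv j
    have hj0 : (j : ℕ) ≠ 0 := fun h => hj (Fin.ext h)
    rw [(mul_eq_zero.1 h1).resolve_right (thetaSeries_pow_ne_zero hj0 j.2 hq0 hq)]
    ring

/-! ### Continuity of C_a and the constant -/

theorem eventually_norm_bounds {z : ℂ} (hz : z ≠ 0) :
    ∀ᶠ w in 𝓝 z, ‖z‖ / 2 < ‖w‖ ∧ ‖w‖ < 2 * ‖z‖ := by
  have h := norm_pos_iff.2 hz
  exact (continuous_norm.continuousAt.eventually_const_lt (by linarith)).and
    (continuous_norm.continuousAt.eventually_lt_const (by linarith))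

theorem continuousAt_coreTheta_of_ne_zero {a : ℕ} (ha : a ≠ 0) {z q : ℂ} (hz : z ≠ 0) (hq0 : q ≠ 0)
    (hq : ‖q‖ < 1) : ContinuousAt (fun w => coreTheta a w q) z := by
  have hpos := norm_pos_iff.2 hz
  let s : Set ℂ := {w | ‖z‖ / 2 < ‖w‖ ∧ ‖w‖ < 2 * ‖z‖}
  have hs : s ∈ 𝓝 z := eventually_norm_bounds hz
  have hs0 : ∀ w ∈ s, w ≠ 0 := fun w hw => norm_pos_iff.1 (by linarith [hw.1])
  have hr : ((‖z‖ / 2 : ℝ) : ℂ) ≠ 0 := by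
    rw [Complex.ofReal_ne_zero]
    positivity
  have hR : ((2 * ‖z‖ : ℝ) : ℂ) ≠ 0 := by
    rw [Complex.ofReal_ne_zero]
    positivity
  have hcont : ContinuousOn (fun w => ∑' p : Fin a × ZeroSumLattice a,
      q ^ coreExponent a p.2.1 * w ^ coreDegree p) s := by
    -- On the annulus, ‖w‖^d is bounded by its value at the outer radius if d ≥ 0 and at the inner
    -- radius if d < 0; the sum of the two covers both.
    refine continuousOn_tsum (fun p w hw => ?_) ((summable_norm_coreMonomial ha hR hq0 hq).add
      (summable_norm_coreMonomial ha hr hq0 hq)) fun p w hw => ?_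
    · exact (continuousAt_const.mul (continuousAt_zpow₀ w _ (.inl (hs0 w hw)))).continuousWithinAt
    · simp only [norm_mul, norm_zpow, norm_div, norm_norm, Real.norm_ofNat, Complex.norm_real, ← mul_add]
      gcongr
      rcases le_or_gt 0 (coreDegree p) with h | h
      · have := zpow_le_zpow_left₀ h (norm_nonneg w) hw.2.le
        have h2 : 0 ≤ (‖z‖ / 2) ^ coreDegree p := by positivity
        linarith
      · have h1 := zpow_le_zpow_left₀ (n := -coreDegree p) (by omega) (by positivity) hw.1.le
        have h2 : 0 ≤ (2 * ‖z‖) ^ coreDegree p := by positivity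
        rw [zpow_neg, zpow_neg] at h1
        have h3 : 0 < ‖w‖ ^ coreDegree p := zpow_pos (norm_pos_iff.2 (hs0 w hw)) _
        have h4 : 0 < (‖z‖ / 2) ^ coreDegree p := by positivity
        have := (inv_le_inv₀ h4 h3).1 h1
        linarith
  refine (hcont.continuousAt hs).congr ?_
  filter_upwards [hs] with w hw
  rw [coreTheta_eq_tsum ha (hs0 w hw) hq0 hq]

theorem coreTheta_mul_qPoch_of_ne_zero {a : ℕ} (ha : 2 ≤ a) {z q : ℂ} (hz : z ≠ 0) (hq0 : q ≠ 0)
    (hq : ‖q‖ < 1) :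
    coreTheta a z q * (qPoch z q * qPoch (z⁻¹ * q) q) =
      eulerE q * eulerE (q ^ a) ^ (a - 2) *
        (qPoch (z ^ a) (q ^ a) * qPoch ((z ^ a)⁻¹ * q ^ a) (q ^ a)) := by
  have ha0 : a ≠ 0 := by omega
  have hqa0 := pow_ne_zero a hq0
  have hqa := norm_pow_lt_one hq ha0
  have hE := eulerE_ne_zero hq
  have hEa := eulerE_ne_zero hqa
  obtain ⟨c, hc⟩ := exists_coreTheta_mul_thetaSeries ha0 hq0 hq
  have h1 : ∀ w : ℂ, w ≠ 0 → coreTheta a w q * (eulerE q * (qPoch w q * qPoch (w⁻¹ * q) q)) =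
      c * (eulerE (q ^ a) * (qPoch (w ^ a) (q ^ a) * qPoch ((w ^ a)⁻¹ * q ^ a) (q ^ a))) :=
    fun w hw => by
      rw [← thetaSeries_eq hw hq0 hq, hc w hw, thetaSeries_eq (pow_ne_zero _ hw) hqa0 hqa]
  -- Both sides of `h1` vanish at w = 1; the factor 1 - w is cancelled off that point, and
  -- continuity recovers the value there.
  have h2 : ∀ᶠ w : ℂ in 𝓝[≠] 1,
      coreTheta a w q * (eulerE q * (qPoch (w * q) q * qPoch (w⁻¹ * q) q)) =
      c * (eulerE (q ^ a) * ((∑ i ∈ Finset.range a, w ^ i) *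
        (qPoch (w ^ a * q ^ a) (q ^ a) * qPoch ((w ^ a)⁻¹ * q ^ a) (q ^ a)))) := by
    filter_upwards [self_mem_nhdsWithin,
      mem_nhdsWithin_of_mem_nhds (isOpen_ne.mem_nhds (one_ne_zero (α := ℂ)))] with w hw1 hw0
    have h3 := h1 w hw0
    rw [qPoch_eq_one_sub_mul hq w, qPoch_eq_one_sub_mul hqa (w ^ a), ← mul_neg_geom_sum] at h3
    have hw : 1 - w ≠ 0 := sub_ne_zero.2 (Ne.symm hw1)
    refine mul_left_cancel₀ hw ?_
    linear_combination h3
  have hinv : ContinuousAt (fun w : ℂ => w⁻¹) 1 := continuousAt_inv₀ one_ne_zero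
  have hcq := continuous_qPoch hq
  have hcqa := continuous_qPoch hqa
  have hL : ContinuousAt (fun w : ℂ =>
      coreTheta a w q * (eulerE q * (qPoch (w * q) q * qPoch (w⁻¹ * q) q))) 1 := by
    refine (continuousAt_coreTheta_of_ne_zero ha0 one_ne_zero hq0 hq).mul
      (continuousAt_const.mul (ContinuousAt.mul ?_ ?_))
    · exact (hcq.comp (continuous_id.mul continuous_const)).continuousAt
    · exact hcq.continuousAt.comp (f := fun w : ℂ => w⁻¹ * q) (hinv.mul continuousAt_const)
  have hR : ContinuousAt (fun w : ℂ => c * (eulerE (q ^ a) * ((∑ i ∈ Finset.range a, w ^ i) *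
      (qPoch (w ^ a * q ^ a) (q ^ a) * qPoch ((w ^ a)⁻¹ * q ^ a) (q ^ a))))) 1 := by
    refine continuousAt_const.mul (continuousAt_const.mul (ContinuousAt.mul (by fun_prop)
      (ContinuousAt.mul ?_ ?_)))
    · exact (hcqa.comp ((continuous_pow a).mul continuous_const)).continuousAt
    · refine hcqa.continuousAt.comp (f := fun w : ℂ => (w ^ a)⁻¹ * q ^ a) ?_
      exact (ContinuousAt.inv₀ (by fun_prop) (by simp)).mul continuousAt_const
  have h4 := tendsto_nhds_unique (hL.tendsto.mono_left nhdsWithin_le_nhds)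
    ((hR.tendsto.mono_left nhdsWithin_le_nhds).congr' (h2.mono fun w hw => hw.symm))
  simp only [inv_one, one_mul, one_pow, Finset.sum_const, Finset.card_range, nsmul_eq_mul, mul_one,
    ← eulerE_eq_qPoch, coreTheta_one] at h4
  have h5 := tsum_coreExponent ha0 hq0 hq
  -- With T the sum of q^(exponent) over the lattice, `h4` reads a T E(q)³ = a c E(q^a)³, and `h5`
  -- gives T E(q) = E(q^a)^a.
  have h6 : c * eulerE (q ^ a) = eulerE q * eulerE q * eulerE (q ^ a) ^ (a - 2) := by
    have haC : (a : ℂ) ≠ 0 := Nat.cast_ne_zero.2 ha0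
    have h7 : eulerE (q ^ a) ^ a = eulerE (q ^ a) ^ (a - 2) * eulerE (q ^ a) ^ 2 := by
      rw [← pow_add]
      congr 1
      omega
    rw [h7] at h5
    refine mul_left_cancel₀ (mul_ne_zero haC (pow_ne_zero 2 hEa)) ?_
    linear_combination -h4 + a * eulerE q ^ 2 * h5
  refine mul_left_cancel₀ hE ?_
  linear_combination h1 z hz + (qPoch (z ^ a) (q ^ a) * qPoch ((z ^ a)⁻¹ * q ^ a) (q ^ a)) * h6

/-! ### The case q = 0 -/

/-- Sum zero allows b_a to be centred: |2i - (a-1)| ≤ a - 1, and a n² - (a-1)|n| ≥ n² for integers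
n. Hence the exponent vanishes only at n = 0. -/
theorem sum_sq_le_two_mul_coreExponent {a : ℕ} {n : Fin a → ℤ} (hn : ∑ i, n i = 0) :
    ∑ i, n i * n i ≤ 2 * coreExponent a n := by
  have h1 : 2 * coreExponent a n =
      ∑ i : Fin a, ((a : ℤ) * (n i * n i) + (2 * ((i : ℕ) : ℤ) - (a - 1)) * n i) := by
    rw [two_mul_coreExponent a n hn, Finset.sum_add_distrib]
    simp only [sub_mul, Finset.sum_sub_distrib, mul_assoc, ← Finset.mul_sum, hn]
    ring
  rw [h1]
  refine Finset.sum_le_sum fun i _ => ?_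
  have hi : ((i : ℕ) : ℤ) + 1 ≤ a := by exact_mod_cast i.2
  have hi0 : (0 : ℤ) ≤ ((i : ℕ) : ℤ) := by positivity
  have ha : (0 : ℤ) ≤ a - 1 := by omega
  rcases le_or_gt 0 (n i) with h | h
  · have h2 : 0 ≤ n i * n i - n i := by
      rcases h.eq_or_lt with h | h
      · simp [← h]
      · nlinarith
    linarith [mul_nonneg ha h2, mul_nonneg hi0 h]
  · have h2 : 0 ≤ n i * n i + n i := by nlinarith
    have h3 : 0 ≤ ((a : ℤ) - 1 - (i : ℕ)) * -n i := mul_nonneg (by omega) (by omega)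
    linarith [mul_nonneg ha h2]

theorem coreThetaTerm_zero {a : ℕ} (z : ℂ) {n : ZeroSumLattice a} (hn : n.1 ≠ 0) :
    coreThetaTerm a z 0 n = 0 := by
  have h : coreExponent a n.1 ≠ 0 := by
    intro h
    have h1 := sum_sq_le_two_mul_coreExponent n.2
    rw [h, mul_zero] at h1
    have h2 := (Finset.sum_eq_zero_iff_of_nonneg fun i _ => mul_self_nonneg (n.1 i)).1
      (le_antisymm h1 (Finset.sum_nonneg fun i _ => mul_self_nonneg (n.1 i)))
    exact hn (funext fun i => mul_self_eq_zero.1 (h2 i (Finset.mem_univ i)))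
  rw [coreThetaTerm, zero_zpow _ h, zero_mul]

theorem hasSum_coreThetaTerm_zero (a : ℕ) (z : ℂ) :
    HasSum (coreThetaTerm a z 0) (∑ j ∈ Finset.range a, z ^ j) := by
  have h := hasSum_single (f := coreThetaTerm a z 0) ⟨0, by simp⟩
    fun n hn => coreThetaTerm_zero z fun h => hn (Subtype.ext h)
  have h1 : coreThetaTerm a z 0 ⟨0, by simp⟩ = ∑ j ∈ Finset.range a, z ^ j := by
    simp [coreThetaTerm, coreExponent, Fin.sum_univ_eq_sum_range (fun j => z ^ j)]
  rwa [h1] at h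

theorem qPoch_zero_right (u : ℂ) : qPoch u 0 = 1 - u := by
  rw [qPoch_eq_one_sub_mul (by simp)]
  simp [qPoch]

theorem coreTheta_mul_qPoch {a : ℕ} (ha : 2 ≤ a) {z q : ℂ} (hz : z ≠ 0) (hq : ‖q‖ < 1) :
    coreTheta a z q * (qPoch z q * qPoch (z⁻¹ * q) q) =
      eulerE q * eulerE (q ^ a) ^ (a - 2) *
        (qPoch (z ^ a) (q ^ a) * qPoch ((z ^ a)⁻¹ * q ^ a) (q ^ a)) := by
  rcases eq_or_ne q 0 with rfl | hq0
  · have ha0 : a ≠ 0 := by omega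
    -- Only n = 0 contributes, and both sides equal 1 - z^a.
    rw [coreTheta, (hasSum_coreThetaTerm_zero a z).tsum_eq, zero_pow ha0]
    simp [qPoch_zero_right, eulerE_eq_qPoch, geom_sum_mul_neg]
  · exact coreTheta_mul_qPoch_of_ne_zero ha hz hq0 hq

theorem continuousAt_coreTheta {a : ℕ} (ha : a ≠ 0) {z q : ℂ} (hz : z ≠ 0) (hq : ‖q‖ < 1) :
    ContinuousAt (fun w => coreTheta a w q) z := by
  rcases eq_or_ne q 0 with rfl | hq0
  · have h : (fun w => coreTheta a w 0) = fun w => ∑ j ∈ Finset.range a, w ^ j :=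
      funext fun w => (hasSum_coreThetaTerm_zero a w).tsum_eq
    rw [h]
    fun_prop
  · exact continuousAt_coreTheta_of_ne_zero ha hz hq0 hq

/-! ### The quotient product and its removable singularities -/

theorem bracketFactor_ne_zero_iff {z q : ℂ} {n : ℕ} :
    bracketFactor z q n ≠ 0 ↔ 1 - z * q ^ n ≠ 0 ∧ 1 - z⁻¹ * q ^ (n + 1) ≠ 0 := mul_ne_zero_iff

theorem tprod_bracketFactor_ne_zero {z q : ℂ} (hq : ‖q‖ < 1) (h : ∀ n, bracketFactor z q n ≠ 0) :
    ∏' n, bracketFactor z q n ≠ 0 := by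
  rw [tprod_bracketFactor hq]
  refine mul_ne_zero (qPoch_ne_zero hq fun n => (bracketFactor_ne_zero_iff.1 (h n)).1)
    (qPoch_ne_zero hq fun n => ?_)
  rw [mul_assoc, ← pow_succ']
  exact (bracketFactor_ne_zero_iff.1 (h n)).2

theorem hasProd_bracketFactor_div {a : ℕ} (ha : 2 ≤ a) {z q : ℂ} (hq : ‖q‖ < 1)
    (h : ∀ n, bracketFactor z q n ≠ 0) :
    HasProd (fun n => bracketFactor (z ^ a) (q ^ a) n / bracketFactor z q n)
      ((∏' n, bracketFactor (z ^ a) (q ^ a) n) / ∏' n, bracketFactor z q n) :=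
  (multipliable_bracketFactor (norm_pow_lt_one hq (by omega)) _).hasProd.div₀
    (multipliable_bracketFactor hq z).hasProd (tprod_bracketFactor_ne_zero hq h)

theorem coreTheta_eq_coreProduct {a : ℕ} (ha : 2 ≤ a) {z q : ℂ} (hz : z ≠ 0) (hq : ‖q‖ < 1)
    (h : ∀ n, bracketFactor z q n ≠ 0) : coreTheta a z q = coreProduct a z q := by
  have h0 := tprod_bracketFactor_ne_zero hq h
  have key := coreTheta_mul_qPoch ha hz hq
  rw [← tprod_bracketFactor hq, ← tprod_bracketFactor (norm_pow_lt_one hq (by omega))] at key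
  rw [coreProduct, (hasProd_bracketFactor_div ha hq h).tprod_eq, ← mul_div_assoc, ← key,
    mul_div_cancel_right₀ _ h0]

theorem eventually_bracketFactor_ne_zero {z q : ℂ} (hz : z ≠ 0) (hq : ‖q‖ < 1) :
    ∀ᶠ w in 𝓝[≠] z, ∀ n, bracketFactor w q n ≠ 0 := by
  have hpos := norm_pos_iff.2 hz
  have hlim : ∀ c : ℝ, Tendsto (fun n : ℕ => c * ‖q‖ ^ n) atTop (𝓝 0) := fun c => by
    simpa using (tendsto_pow_atTop_nhds_zero_of_lt_one (norm_nonneg q) hq).const_mul c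
  -- From N on, no factor vanishes anywhere in the annulus around z, so only finitely many zeros
  -- have to be avoided.
  obtain ⟨N, hN⟩ := eventually_atTop.1
    (((hlim (2 * ‖z‖)).eventually_lt_const one_pos).and
      (((tendsto_add_atTop_iff_nat 1).2 (hlim (‖z‖ / 2)⁻¹)).eventually_lt_const one_pos))
  have hne : ∀ c : ℂ, ∀ᶠ w in 𝓝[≠] z, w ≠ c := fun c => by
    rcases eq_or_ne c z with rfl | h
    · exact self_mem_nhdsWithin
    · exact mem_nhdsWithin_of_mem_nhds (isOpen_ne.mem_nhds h.symm)
  have hfin : ∀ᶠ w in 𝓝[≠] z, ∀ n ∈ Finset.range N, w ≠ (q ^ n)⁻¹ ∧ w ≠ q ^ (n + 1) :=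
    (Finset.eventually_all _).2 fun n _ => (hne _).and (hne _)
  filter_upwards [hfin, mem_nhdsWithin_of_mem_nhds (eventually_norm_bounds hz)] with w hw hb n
  have hw0 : w ≠ 0 := norm_pos_iff.1 (by linarith [hb.1])
  rw [bracketFactor_ne_zero_iff]
  rcases lt_or_ge n N with hn | hn
  · obtain ⟨h1, h2⟩ := hw n (Finset.mem_range.2 hn)
    refine ⟨fun h => h1 (eq_inv_of_mul_eq_one_left (sub_eq_zero.1 h).symm), fun h => h2 ?_⟩
    have h3 := sub_eq_zero.1 h
    field_simp at h3
    exact h3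
  · obtain ⟨h1, h2⟩ := hN n hn
    constructor
    · refine one_sub_ne_zero_of_norm_lt_one (lt_of_le_of_lt ?_ h1)
      rw [norm_mul, norm_pow]
      gcongr
      exact hb.2.le
    · refine one_sub_ne_zero_of_norm_lt_one (lt_of_le_of_lt ?_ h2)
      rw [norm_mul, norm_pow, norm_inv]
      gcongr
      exact hb.1.le

theorem theorem1 (a : ℕ) (ha : 2 ≤ a) (q : ℂ) (hq : ‖q‖ < 1) (z : ℂ) (hz : z ≠ 0) :
    -- the series converges absolutely
    Summable (coreThetaTerm a z q) ∧
    -- the identity, wherever no denominator vanishes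
    ((∀ n : ℕ, bracketFactor z q n ≠ 0) →
      Multipliable (fun n : ℕ => bracketFactor (z ^ a) (q ^ a) n / bracketFactor z q n) ∧
      coreTheta a z q = coreProduct a z q) ∧
    -- the singularities of the product side are removable, with the value given by the series
    Tendsto (fun w : ℂ => coreProduct a w q) (𝓝[≠] z) (𝓝 (coreTheta a z q)) := by
  have ha0 : a ≠ 0 := by omega
  refine ⟨?_, fun h => ⟨(hasProd_bracketFactor_div ha hq h).multipliable,
    coreTheta_eq_coreProduct ha hz hq h⟩, ?_⟩
  · rcases eq_or_ne q 0 with rfl | hq0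
    · exact (hasSum_coreThetaTerm_zero a z).summable
    · exact summable_coreThetaTerm ha0 hz hq0 hq
  · refine ((continuousAt_coreTheta ha0 hz hq).tendsto.mono_left nhdsWithin_le_nhds).congr' ?_
    filter_upwards [eventually_bracketFactor_ne_zero hz hq,
      mem_nhdsWithin_of_mem_nhds (isOpen_ne.mem_nhds hz)] with w hw hw0
    exact coreTheta_eq_coreProduct ha hw0 hq hw
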